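/- Let $W$ be the principal branch of the Lambert $W$ function, i.e. the inverse of $w\mapsto we^w$ restricted to the set of all $w=u+iv$ with $|v|<\pi$ that lie to the right of the curve $u=-v\cot v$ ($u=-1$ for $v=0$) or on its part $v\ge 0$; its branch cut is $(-\infty,-1/e]$, on which it is continuous from above. For every $z\in\mathbb{C}\setminus(-\infty,0]$ (that is, $z\neq 0$ and $|\arg z|<\pi$), $W$ is complex differentiable at $z$, the integral below converges absolutely, and $$W'(z)=\frac1\pi\int_0^\pi\frac{dv}{z+v\csc(v)\,e^{-v\cot v}} .$$ This is a Stieltjes-integral representation of $W'$: if $\mu$ denotes the image of the measure $\frac1\pi\,dv$ on $(0,\pi)$ under $v\mapsto v\csc(v)e^{-v\cot v}$, then $\mu$ is a positive measure on $[0,\infty)$, $\int_0^\infty(1+t)^{-1}\,d\mu(t)<\infty$, and for all $z\in\mathbb{C}\setminus(-\infty,0]$ the following integral converges absolutely and $$W'(z)=\int_0^\infty\frac{d\mu(t)}{z+t}.$$ -/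

import Mathlib

noncomputable section

/-- The range of the principal branch of the Lambert `W` function. In the `w`-plane, `w = u + i v`,
it is the region `|v| < π` to the right of the curve `u = -v cot v` (`-π < v < π`, with the value
`u = -1` at `v = 0`), together with the part `v ≥ 0` of that curve. The upper part of the curve
belongs to the range because `W` is continuous from above on its branch cut `(-∞, -1/e]`. -/
def lambertRange : Set ℂ :=
  {w : ℂ | (0 < w.im ∧ w.im < Real.pi ∧ -(w.im * Real.cot w.im) ≤ w.re) ∨
    (w.im = 0 ∧ -1 ≤ w.re) ∨
    (w.im < 0 ∧ -Real.pi < w.im ∧ -(w.im * Real.cot w.im) < w.re)}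

/-- The principal branch of the Lambert `W` function: the inverse of `w ↦ w * exp w`
restricted to `lambertRange`. -/
def lambertW : ℂ → ℂ :=
  Function.invFunOn (fun w : ℂ => w * Complex.exp w) lambertRange

/-- The function `v ↦ v csc v exp (-v cot v)` on `(0, π)`. -/
def stieltjesKernel (v : ℝ) : ℝ :=
  v * (Real.sin v)⁻¹ * Real.exp (-(v * Real.cot v))

/-- `f z = a + ∫ dμ(t) / (z + t)` on the cut plane `ℂ \ (-∞, 0]`, where `a ≥ 0` and `μ` is a positive
measure on `[0, ∞)` such that `∫ (1 + t)⁻¹ dμ(t) < ∞`. -/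
structure HasStieltjesRepresentation
    (f : ℂ → ℂ) (a : ℝ) (μ : MeasureTheory.Measure ℝ) : Prop where
  nonneg : 0 ≤ a
  supported : μ (Set.Iio 0) = 0
  finite : ∫⁻ t, ENNReal.ofReal (1 + t)⁻¹ ∂μ < ⊤
  integrable : ∀ z ∈ Complex.slitPlane,
    MeasureTheory.Integrable (fun t : ℝ => 1 / (z + (t : ℂ))) μ
  eq_integral : ∀ z ∈ Complex.slitPlane, f z = (a : ℂ) + ∫ t : ℝ, 1 / (z + (t : ℂ)) ∂μ

/-- The image of the measure `dv / π` on `(0, π)` under `v ↦ v csc v exp (-v cot v)`. -/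
def lambertDerivMeasure : MeasureTheory.Measure ℝ :=
  (ENNReal.ofReal (1 / Real.pi) •
    MeasureTheory.volume.restrict (Set.Ioo 0 Real.pi)).map stieltjesKernel

end

open Complex MeasureTheory Set Filter Topology

/-! Write `K` for `stieltjesKernel`. The formula integrates to `W(z) = L(z)`, where `L(z) = (1/π) ∫
log (1 + z / K v) dv` is `lambertIntegral`, so it suffices to identify `W` with `L` and
differentiate under the integral.

Near `0`, the coefficients of `L'` are the moments of `1 / K`. In the coordinate `w = exp ζ` the
form `(w * exp w)⁻ⁿ dw` has an entire primitive, so the upper unit semicircle can be traded for the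
curve `u = -v cot v`, where `w * exp w = -K v`. This turns moments into circle integrals
(`moment_eq_circleIntegral`). Summing gives `∮ dw / (w * exp w - z)`, which Cauchy's formula
evaluates at `z = a * exp a`; hence `L(a * exp a) = a` for small `a`.

The identity theorem extends `L * exp L = z` to the cut plane. The imaginary part of `L` is a mean
of arguments, which places `L` in `lambertRange`. Injectivity there (`mul_exp_injOn_lambertRange`)
gives `W = L`. -/

/-! ### Bounds for the kernel -/

lemma stieltjesKernel_pos {v : ℝ} (hv : v ∈ Ioo 0 Real.pi) : 0 < stieltjesKernel v := by
  have := Real.sin_pos_of_pos_of_lt_pi hv.1 hv.2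
  have := hv.1
  unfold stieltjesKernel
  positivity

lemma mul_cot_le_one {v : ℝ} (hv : v ∈ Ioo 0 Real.pi) : v * Real.cot v ≤ 1 := by
  have hs := Real.sin_pos_of_pos_of_lt_pi hv.1 hv.2
  rw [Real.cot_eq_cos_div_sin, ← mul_div_assoc, div_le_one hs]
  rcases lt_or_ge v (Real.pi / 2) with h | h
  · have hc := Real.cos_pos_of_mem_Ioo ⟨by linarith [hv.1, Real.pi_pos], h⟩
    have := Real.lt_tan hv.1 h
    rw [Real.tan_eq_sin_div_cos, lt_div_iff₀ hc] at this
    exact this.le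
  · have hc := Real.cos_nonpos_of_pi_div_two_le_of_le h (by linarith [hv.2])
    nlinarith [hv.1]

lemma exp_neg_one_le_stieltjesKernel {v : ℝ} (hv : v ∈ Ioo 0 Real.pi) :
    Real.exp (-1) ≤ stieltjesKernel v := by
  have hs := Real.sin_pos_of_pos_of_lt_pi hv.1 hv.2
  have h1 : 1 ≤ v * (Real.sin v)⁻¹ := by
    rw [← div_eq_mul_inv, one_le_div hs]
    exact (Real.sin_lt hv.1).le
  have h2 : Real.exp (-1) ≤ Real.exp (-(v * Real.cot v)) :=
    Real.exp_le_exp.2 (neg_le_neg (mul_cot_le_one hv))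
  unfold stieltjesKernel
  nlinarith [Real.exp_pos (-1)]

lemma inv_stieltjesKernel_mem_Icc {v : ℝ} (hv : v ∈ Icc 0 Real.pi) :
    (stieltjesKernel v)⁻¹ ∈ Icc 0 (Real.exp 1) := by
  rcases hv.1.eq_or_lt with rfl | h0
  -- At both endpoints `0⁻¹ = 0` makes the kernel and its inverse `0`, so the closed interval causes
  -- no exception.
  · simp [stieltjesKernel, Real.exp_nonneg]
  rcases hv.2.eq_or_lt with rfl | hπ
  · simp [stieltjesKernel, Real.exp_nonneg]
  · refine ⟨(inv_pos.2 (stieltjesKernel_pos ⟨h0, hπ⟩)).le, ?_⟩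
    have := inv_anti₀ (Real.exp_pos _) (exp_neg_one_le_stieltjesKernel ⟨h0, hπ⟩)
    rwa [Real.exp_neg, inv_inv] at this

lemma measurable_stieltjesKernel : Measurable stieltjesKernel := by
  unfold stieltjesKernel
  simp_rw [Real.cot_eq_cos_div_sin]
  fun_prop

/-! ### Injectivity of `w * exp w` -/

lemma mul_exp_im (w : ℂ) : (w * exp w).im =
    Real.exp w.re * (w.re * Real.sin w.im + w.im * Real.cos w.im) := by
  rw [mul_im, exp_re, exp_im]; ring

/-- Along the segment from `w₁` to `w₂`, the derivative of `w + log w` divided by `w₂ - w₁` is `1 +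
1/w`, whose imaginary part is negative in the upper half-plane. Equal endpoint values would make it
vanish somewhere, by the mean value theorem. -/
lemma eq_of_add_log_eq {w₁ w₂ : ℂ} (h₁ : 0 < w₁.im) (h₂ : 0 < w₂.im)
    (h : w₁ + log w₁ = w₂ + log w₂) : w₁ = w₂ := by
  by_contra hne
  have hd : w₂ - w₁ ≠ 0 := sub_ne_zero.2 (Ne.symm hne)
  set p : ℝ → ℂ := fun t => w₁ + t * (w₂ - w₁) with hp
  have hpim : ∀ t ∈ Icc (0 : ℝ) 1, 0 < (p t).im := by
    intro t ht
    have : (p t).im = (1 - t) * w₁.im + t * w₂.im := by simp [hp]; ring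
    rw [this]
    rcases ht.1.eq_or_lt with rfl | h0
    · simpa using h₁
    · have := mul_pos h0 h₂
      have := mul_nonneg (sub_nonneg.2 ht.2) h₁.le
      linarith
  have hpd : ∀ t, HasDerivAt p (w₂ - w₁) t := by
    intro t
    have := ((hasDerivAt_id t).ofReal_comp.mul_const (w₂ - w₁)).const_add w₁
    rwa [ofReal_one, one_mul] at this
  have hder : ∀ t ∈ Icc (0 : ℝ) 1, HasDerivAt (fun t => ((p t + log (p t)) / (w₂ - w₁)).im)
      (1 + (p t)⁻¹).im t := by
    intro t ht
    have hsl : p t ∈ slitPlane := Or.inr (hpim t ht).ne'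
    have h3 := (((hpd t).add ((hasDerivAt_log hsl).comp t (hpd t))).div_const (w₂ - w₁))
    have h4 := (imCLM.hasFDerivAt.comp_hasDerivAt t h3)
    rw [show (w₂ - w₁ + (p t)⁻¹ * (w₂ - w₁)) / (w₂ - w₁) = 1 + (p t)⁻¹ by field_simp] at h4
    exact h4
  have := exists_hasDerivAt_eq_slope _ _ (zero_lt_one' ℝ)
    (fun t ht => (hder t ht).continuousAt.continuousWithinAt)
    (fun t ht => hder t (Ioo_subset_Icc_self ht))
  obtain ⟨c, hc, hc2⟩ := this
  have hcim := hpim c (Ioo_subset_Icc_self hc)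
  have e0 : p 0 = w₁ := by simp [hp]
  have e1 : p 1 = w₂ := by simp [hp]
  rw [e0, e1, h] at hc2
  simp only [add_im, one_im, inv_im, sub_self, zero_div, zero_add] at hc2
  have hn : 0 < normSq (p c) := normSq_pos.2 (fun h0 => by simp [h0] at hcim)
  have := div_pos hcim hn
  rw [neg_div] at hc2
  linarith

/-- Here `w + log w` is a logarithm of `w * exp w` with imaginary part in `(0, 2π)`, so equal
exponentials force equal logarithms. -/
lemma mul_exp_injOn_strip {w₁ w₂ : ℂ} (h₁ : w₁.im ∈ Ioo 0 Real.pi) (h₂ : w₂.im ∈ Ioo 0 Real.pi)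
    (h : w₁ * exp w₁ = w₂ * exp w₂) : w₁ = w₂ := by
  have key : ∀ w : ℂ, w.im ∈ Ioo 0 Real.pi → exp (w + log w) = w * exp w ∧
      0 < (w + log w).im ∧ (w + log w).im < 2 * Real.pi := by
    intro w hw
    have hw0 : w ≠ 0 := fun h0 => by simp [h0] at hw
    have harg : 0 ≤ arg w := arg_nonneg_iff.2 hw.1.le
    have harg' := arg_le_pi w
    refine ⟨by rw [exp_add, exp_log hw0, mul_comm], ?_, ?_⟩ <;>
      simp only [add_im, log_im] <;> linarith [hw.1, hw.2]
  obtain ⟨e₁, l₁, u₁⟩ := key w₁ h₁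
  obtain ⟨e₂, l₂, u₂⟩ := key w₂ h₂
  refine eq_of_add_log_eq h₁.1 h₂.1 ?_
  obtain ⟨n, hn⟩ := exp_eq_exp_iff_exists_int.1 (e₁.trans (h.trans e₂.symm))
  have him := congrArg im hn
  have : (w₂ + log w₂ + n * (2 * Real.pi * I)).im = (w₂ + log w₂).im + n * (2 * Real.pi) := by
    simp
  rw [this] at him
  have hpi := Real.pi_pos
  have hn1 : (n : ℝ) < 1 := by nlinarith
  have hn2 : (-1 : ℝ) < n := by nlinarith
  have hn0 : n = 0 := by
    have : n < 1 := by exact_mod_cast hn1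
    have : -1 < n := by exact_mod_cast hn2
    omega
  rw [hn, hn0]; simp

lemma im_mul_exp_pos_iff {w : ℂ} (hw : w.im ∈ Ioo 0 Real.pi) :
    0 < (w * exp w).im ↔ -(w.im * Real.cot w.im) < w.re := by
  have hs := Real.sin_pos_of_pos_of_lt_pi hw.1 hw.2
  rw [mul_exp_im, Real.cot_eq_cos_div_sin, mul_pos_iff_of_pos_left (Real.exp_pos _),
    ← mul_div_assoc, neg_lt_iff_pos_add, show w.re + w.im * Real.cos w.im / Real.sin w.im =
      (w.re * Real.sin w.im + w.im * Real.cos w.im) / Real.sin w.im by field_simp,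
    div_pos_iff_of_pos_right hs]

/-- With `v = w.im`, points of the curve are `w = -(v / sin v) exp (-i v)`, and the phase cancels
against that of `exp w`. -/
lemma mul_exp_of_eq_neg_mul_cot {w : ℂ} (hw : w.im ∈ Ioo 0 Real.pi)
    (h : w.re = -(w.im * Real.cot w.im)) : w * exp w = -(stieltjesKernel w.im : ℂ) := by
  have hs := Real.sin_pos_of_pos_of_lt_pi hw.1 hw.2
  have hsq := Real.sin_sq_add_cos_sq w.im
  have h0 : (w * exp w).im = 0 := by
    rw [mul_exp_im, h, Real.cot_eq_cos_div_sin]; field_simp; ring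
  apply Complex.ext
  · rw [neg_re, ofReal_re, stieltjesKernel, mul_re, exp_re, exp_im, ← h]
    rw [show w.re = -(w.im * (Real.cos w.im / Real.sin w.im)) by
      rw [h, Real.cot_eq_cos_div_sin]]
    generalize Real.exp _ = E
    field_simp
    linear_combination -(w.im * E) * hsq
  · rw [h0]; simp

lemma conj_mul_exp (w : ℂ) : (starRingEnd ℂ) w * exp ((starRingEnd ℂ) w) =
    (starRingEnd ℂ) (w * exp w) := by rw [exp_conj, map_mul]

lemma im_mul_exp_neg_iff {w : ℂ} (hw : -w.im ∈ Ioo 0 Real.pi) :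
    (w * exp w).im < 0 ↔ -(w.im * Real.cot w.im) < w.re := by
  have h := im_mul_exp_pos_iff (w := (starRingEnd ℂ) w) (by simpa using hw)
  rw [conj_mul_exp, conj_im, conj_im, conj_re, Left.neg_pos_iff] at h
  rw [h, Real.cot_eq_cos_div_sin, Real.cot_eq_cos_div_sin, Real.cos_neg, Real.sin_neg, div_neg,
    neg_mul_neg]

/-- The sign of the imaginary part of the image tells which piece of the range contains `w`. The
slit-plane hypothesis discards the boundary curve and the real interval `[-1, 0]`. Conjugation
reduces the lower piece to the upper one. -/
lemma mul_exp_injOn_lambertRange {w₁ w₂ : ℂ} (h₁ : w₁ ∈ lambertRange) (h₂ : w₂ ∈ lambertRange)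
    (h : w₁ * exp w₁ = w₂ * exp w₂) (hsl : w₁ * exp w₁ ∈ slitPlane) : w₁ = w₂ := by
  have key : ∀ w ∈ lambertRange, w * exp w ∈ slitPlane →
      (w.im ∈ Ioo 0 Real.pi ∧ 0 < (w * exp w).im) ∨
      (w.im = 0 ∧ 0 < w.re ∧ (w * exp w).im = 0) ∨
      (-w.im ∈ Ioo 0 Real.pi ∧ (w * exp w).im < 0) := by
    rintro w (⟨h1, h2, h3⟩ | ⟨h1, h2⟩ | ⟨h1, h2, h3⟩) hw
    · refine Or.inl ⟨⟨h1, h2⟩, (im_mul_exp_pos_iff ⟨h1, h2⟩).2 (h3.lt_of_ne fun h4 => ?_)⟩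
      rw [mul_exp_of_eq_neg_mul_cot ⟨h1, h2⟩ h4.symm, mem_slitPlane_iff] at hw
      have := stieltjesKernel_pos ⟨h1, h2⟩
      simp at hw
      linarith
    · have him : (w * exp w).im = 0 := by rw [mul_exp_im, h1]; simp
      have hre : (w * exp w).re = w.re * Real.exp w.re := by
        rw [mul_re, exp_re, exp_im, h1]; simp
      refine Or.inr (Or.inl ⟨h1, ?_, him⟩)
      have := (mem_slitPlane_iff.1 hw).resolve_right (by simp [him])
      rw [hre] at this
      exact (mul_pos_iff_of_pos_right (Real.exp_pos _)).1 this
    · have h4 : -w.im ∈ Ioo 0 Real.pi := ⟨by linarith, by linarith⟩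
      exact Or.inr (Or.inr ⟨h4, (im_mul_exp_neg_iff h4).2 h3⟩)
  rcases key w₁ h₁ hsl with ⟨a1, a2⟩ | ⟨a1, a2, a3⟩ | ⟨a1, a2⟩ <;>
    rcases key w₂ h₂ (h ▸ hsl) with ⟨b1, b2⟩ | ⟨b1, b2, b3⟩ | ⟨b1, b2⟩ <;>
    (try rw [← h] at b2) <;> (try rw [← h] at b3) <;> try (exfalso; linarith)
  · exact mul_exp_injOn_strip a1 b1 h
  · have e : ∀ w : ℂ, w.im = 0 → (w * exp w).re = w.re * Real.exp w.re := by
      intro w hw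
      rw [mul_re, exp_re, exp_im, hw]; simp
    have hre := congrArg re h
    rw [e _ a1, e _ b1] at hre
    refine Complex.ext ?_ (a1.trans b1.symm)
    rcases lt_trichotomy w₁.re w₂.re with hlt | heq | hlt
    · exact absurd hre (mul_lt_mul'' hlt (Real.exp_lt_exp.2 hlt) a2.le (Real.exp_nonneg _)).ne
    · exact heq
    · exact absurd hre (mul_lt_mul'' hlt (Real.exp_lt_exp.2 hlt) b2.le (Real.exp_nonneg _)).ne'
  · have := mul_exp_injOn_strip (w₁ := (starRingEnd ℂ) w₁) (w₂ := (starRingEnd ℂ) w₂)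
      (by simpa using a1) (by simpa using b1) (by rw [conj_mul_exp, conj_mul_exp, h])
    exact (starRingEnd ℂ).injective this

/-! ### The logarithmic integral and its derivative -/

/-- The function `z ↦ (1 / π) ∫ log (1 + z / K v) dv` over `(0, π)`, with `K = stieltjesKernel`;
it is an explicit formula for `lambertW` on the cut plane. -/
noncomputable def lambertIntegral (z : ℂ) : ℂ :=
  1 / (Real.pi : ℂ) * ∫ v in (0 : ℝ)..Real.pi, log (1 + z * ((stieltjesKernel v)⁻¹ : ℝ))

/-- The derivative of `lambertIntegral`. -/
noncomputable def lambertDerivIntegral (z : ℂ) : ℂ :=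
  1 / (Real.pi : ℂ) * ∫ v in (0 : ℝ)..Real.pi,
    ((stieltjesKernel v)⁻¹ : ℝ) / (1 + z * ((stieltjesKernel v)⁻¹ : ℝ))

lemma one_add_mul_mem_slitPlane {z : ℂ} (hz : z ∈ slitPlane) {s : ℝ} (hs : 0 ≤ s) :
    1 + z * s ∈ slitPlane := by
  rcases hs.eq_or_lt with rfl | hs
  · simp
  rw [mem_slitPlane_iff] at hz ⊢
  rcases hz with hz | hz
  · left
    simp only [add_re, one_re, re_mul_ofReal]
    positivity
  · right
    simpa [im_mul_ofReal] using ⟨hz, hs.ne'⟩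

lemma one_add_mul_mem_slitPlane_of_norm_lt {z : ℂ} (hz : ‖z‖ < Real.exp (-1)) {s : ℝ}
    (hs : s ∈ Icc 0 (Real.exp 1)) : 1 + z * s ∈ slitPlane := by
  left
  simp only [add_re, one_re, re_mul_ofReal]
  have h1 := (abs_le.1 (abs_re_le_norm z)).1
  have h2 : Real.exp (-1) * Real.exp 1 = 1 := by rw [← Real.exp_add]; simp
  have h3 : ‖z‖ * s ≤ ‖z‖ * Real.exp 1 := by gcongr; exact hs.2
  have h4 : ‖z‖ * Real.exp 1 < 1 := (mul_lt_mul_of_pos_right hz (Real.exp_pos 1)).trans_eq h2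
  have h5 : -‖z‖ * s ≤ z.re * s := by gcongr; exact hs.1
  linarith

lemma uIoc_zero_pi_subset {v : ℝ} (hv : v ∈ Set.uIoc 0 Real.pi) : v ∈ Icc 0 Real.pi := by
  rw [uIoc_of_le Real.pi_pos.le] at hv
  exact Ioc_subset_Icc_self hv

lemma intervalIntegrable_comp_inv_stieltjesKernel {g : ℝ → ℂ} (hg : Measurable g)
    (hc : ContinuousOn g (Icc 0 (Real.exp 1))) :
    IntervalIntegrable (fun v => g (stieltjesKernel v)⁻¹) volume 0 Real.pi := by
  obtain ⟨C, hC⟩ := isCompact_Icc.exists_bound_of_continuousOn hc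
  refine (intervalIntegrable_const (c := C)).mono_fun
    (hg.comp measurable_stieltjesKernel.inv).aestronglyMeasurable ?_
  filter_upwards [ae_restrict_mem measurableSet_uIoc] with v hv
  exact (hC _ (inv_stieltjesKernel_mem_Icc (uIoc_zero_pi_subset hv))).trans (le_abs_self C)

/-- The values `1 / K v` lie in the compact interval `[0, e]`, so a closed ball around `z` admits
one bound on the differentiated integrand. The hypothesis covers both the slit plane and the disc
`‖z‖ < 1/e`, which contains `0`. -/
lemma intervalIntegrable_and_hasDerivAt_lambertIntegral {z : ℂ}
    (hz : ∀ s : ℝ, s ∈ Icc 0 (Real.exp 1) → 1 + z * s ∈ slitPlane) :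
    IntervalIntegrable (fun v => (((stieltjesKernel v)⁻¹ : ℝ) : ℂ) /
      (1 + z * ((stieltjesKernel v)⁻¹ : ℝ))) volume 0 Real.pi ∧
    HasDerivAt lambertIntegral (lambertDerivIntegral z) z := by
  have hmeas : Measurable fun v => (((stieltjesKernel v)⁻¹ : ℝ) : ℂ) :=
    measurable_ofReal.comp measurable_stieltjesKernel.inv
  have hopen : ∀ᶠ x : ℂ in 𝓝 z, ∀ s : ℝ, s ∈ Icc 0 (Real.exp 1) → 1 + x * s ∈ slitPlane := by
    refine isCompact_Icc.eventually_forall_of_forall_eventually fun s hs => ?_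
    have : ContinuousAt (fun p : ℂ × ℝ => 1 + p.1 * (p.2 : ℂ)) (z, s) := by fun_prop
    exact this.eventually (isOpen_slitPlane.mem_nhds (hz s hs))
  obtain ⟨ε, hε, hball⟩ := Metric.nhds_basis_closedBall.mem_iff.1 hopen
  have hcont : ContinuousOn (fun p : ℂ × ℝ => (p.2 : ℂ) / (1 + p.1 * (p.2 : ℂ)))
      (Metric.closedBall z ε ×ˢ Icc 0 (Real.exp 1)) := by
    refine ContinuousOn.div (by fun_prop) (by fun_prop) fun p hp => ?_
    exact slitPlane_ne_zero (hball hp.1 p.2 hp.2)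
  obtain ⟨C, hC⟩ := ((isCompact_closedBall z ε).prod isCompact_Icc).exists_bound_of_continuousOn
    hcont
  have hlog : ContinuousOn (fun s : ℝ => log (1 + z * s)) (Icc 0 (Real.exp 1)) := by
    refine ContinuousOn.clog (by fun_prop) hz
  have := intervalIntegral.hasDerivAt_integral_of_dominated_loc_of_deriv_le
    (F := fun x v => log (1 + x * ((stieltjesKernel v)⁻¹ : ℝ)))
    (F' := fun x v => (((stieltjesKernel v)⁻¹ : ℝ) : ℂ) / (1 + x * ((stieltjesKernel v)⁻¹ : ℝ)))
    (x₀ := z) (μ := volume) (a := 0) (b := Real.pi) (bound := fun _ => C)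
    (Metric.closedBall_mem_nhds z hε)
    (Eventually.of_forall fun x =>
      ((measurable_const.add (measurable_const.mul hmeas)).clog).aestronglyMeasurable)
    (intervalIntegrable_comp_inv_stieltjesKernel (g := fun s => log (1 + z * s))
      (by fun_prop) hlog)
    ((hmeas.div (measurable_const.add (measurable_const.mul hmeas))).aestronglyMeasurable)
    (Eventually.of_forall fun v hv x hx => hC (x, _)
      ⟨hx, inv_stieltjesKernel_mem_Icc (uIoc_zero_pi_subset hv)⟩)
    intervalIntegrable_const
    (Eventually.of_forall fun v hv x hx => by
      have h1 := hball hx _ (inv_stieltjesKernel_mem_Icc (uIoc_zero_pi_subset hv))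
      have h2 := (((hasDerivAt_id x).mul_const (((stieltjesKernel v)⁻¹ : ℝ) : ℂ)).const_add 1).clog
        h1
      simpa using h2)
  exact ⟨this.1, this.2.const_mul _⟩

lemma lambertIntegral_zero : lambertIntegral 0 = 0 := by simp [lambertIntegral]

/-! ### Moments as contour integrals -/

/-- The integrand of `∮ (w * exp w) ^ (-n) dw` in the logarithmic coordinate `w = exp ζ`. -/
noncomputable def logIntegrand (n : ℕ) (ζ : ℂ) : ℂ := exp (ζ - n * ζ - n * exp ζ)

lemma logIntegrand_eq (n : ℕ) (ζ : ℂ) :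
    logIntegrand n ζ = exp ζ * ((exp ζ * exp (exp ζ)) ^ n)⁻¹ := by
  rw [logIntegrand, mul_pow, ← exp_nat_mul, ← exp_nat_mul, ← exp_add, ← exp_neg, ← exp_add]
  congr 1; ring

lemma differentiable_logIntegrand (n : ℕ) : Differentiable ℂ (logIntegrand n) := by
  unfold logIntegrand; fun_prop

lemma logIntegrand_conj (n : ℕ) (ζ : ℂ) :
    logIntegrand n ((starRingEnd ℂ) ζ) = (starRingEnd ℂ) (logIntegrand n ζ) := by
  simp only [logIntegrand, ← exp_conj, map_sub, map_mul, map_natCast]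

lemma norm_logIntegrand_le_one {n : ℕ} (hn : 1 ≤ n) {ζ : ℂ} (hre : 0 ≤ ζ.re)
    (him : |ζ.im| ≤ Real.pi / 2) : ‖logIntegrand n ζ‖ ≤ 1 := by
  rw [logIntegrand, norm_exp, Real.exp_le_one_iff]
  have hc := Real.cos_nonneg_of_mem_Icc (abs_le.1 him)
  have hn' : (1 : ℝ) ≤ n := by exact_mod_cast hn
  have h1 : (ζ - n * ζ - n * exp ζ).re =
      -((n - 1) * ζ.re) - n * (Real.exp ζ.re * Real.cos ζ.im) := by
    simp [exp_re]; ring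
  have h2 := mul_nonneg (sub_nonneg.2 hn') hre
  have h3 : 0 ≤ n * (Real.exp ζ.re * Real.cos ζ.im) := by positivity
  rw [h1]; linarith

/-- A logarithm of the point `-v cot v + i v` of the curve bounding `lambertRange`. -/
noncomputable def logBoundary (v : ℝ) : ℂ := (-Real.log (Real.sinc v) : ℝ) + (Real.pi - v : ℝ) * I

lemma sinc_pos {v : ℝ} (hv : v ∈ Ioo 0 Real.pi) : 0 < Real.sinc v := by
  rw [Real.sinc_of_ne_zero hv.1.ne']
  exact div_pos (Real.sin_pos_of_pos_of_lt_pi hv.1 hv.2) hv.1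

lemma exp_logBoundary {v : ℝ} (hv : v ∈ Ioo 0 Real.pi) :
    exp (logBoundary v) = (-(v * Real.cot v) : ℝ) + v * I := by
  have hs := Real.sin_pos_of_pos_of_lt_pi hv.1 hv.2
  have hv0 := hv.1
  have hre : (logBoundary v).re = -Real.log (Real.sinc v) := by simp [logBoundary]
  have him : (logBoundary v).im = Real.pi - v := by simp [logBoundary]
  have hE : Real.exp (logBoundary v).re = v / Real.sin v := by
    rw [hre, Real.exp_neg, Real.exp_log (sinc_pos hv), Real.sinc_of_ne_zero hv.1.ne', inv_div]
  apply Complex.ext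
  · rw [exp_re, hE, him, Real.cos_pi_sub, add_re, ofReal_re, re_ofReal_mul, I_re,
      Real.cot_eq_cos_div_sin]
    field_simp; simp
  · rw [exp_im, hE, him, Real.sin_pi_sub, add_im, ofReal_im, im_ofReal_mul, I_im]
    field_simp; simp

lemma hasDerivAt_logBoundary {v : ℝ} (hv : v ∈ Ioo 0 Real.pi) :
    HasDerivAt logBoundary ((v⁻¹ - Real.cot v : ℝ) - I) v := by
  have hs := Real.sin_pos_of_pos_of_lt_pi hv.1 hv.2
  have hv0 := hv.1
  have h1 : HasDerivAt (fun v => -Real.log (Real.sinc v)) (v⁻¹ - Real.cot v) v := by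
    have h2 : HasDerivAt (fun v => Real.log v - Real.log (Real.sin v)) (v⁻¹ - Real.cot v) v := by
      rw [Real.cot_eq_cos_div_sin]
      exact (Real.hasDerivAt_log hv.1.ne').sub ((Real.hasDerivAt_sin v).log hs.ne')
    refine h2.congr_of_eventuallyEq ?_
    filter_upwards [Ioo_mem_nhds hv.1 hv.2] with x hx
    rw [Real.sinc_of_ne_zero hx.1.ne',
      Real.log_div (Real.sin_pos_of_pos_of_lt_pi hx.1 hx.2).ne' hx.1.ne']
    ring
  have h3 := h1.ofReal_comp.add
    (((hasDerivAt_id v).const_sub Real.pi).ofReal_comp.mul_const I)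
  rw [ofReal_neg, ofReal_one, neg_one_mul, ← sub_eq_add_neg] at h3
  exact h3

/-- On the curve `(w * exp w) ^ n` is real, and `w.im = v` gives `dw` imaginary part `dv`. -/
lemma im_logIntegrand_logBoundary_mul (n : ℕ) {v : ℝ} (hv : v ∈ Ioo 0 Real.pi) :
    (logIntegrand n (logBoundary v) * ((v⁻¹ - Real.cot v : ℝ) - I)).im =
      (-1) ^ n * (stieltjesKernel v)⁻¹ ^ n := by
  have hv0 := hv.1.ne'
  have hw := mul_exp_of_eq_neg_mul_cot (w := exp (logBoundary v))
  have him : (exp (logBoundary v)).im = v := by 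
    rw [exp_logBoundary hv, add_im, ofReal_im, im_ofReal_mul, I_im]; simp
  have hre : (exp (logBoundary v)).re = -(v * Real.cot v) := by
    rw [exp_logBoundary hv, add_re, ofReal_re, re_ofReal_mul, I_re]; simp
  rw [him] at hw
  rw [logIntegrand_eq, hw hv hre, mul_right_comm,
    show ((-(stieltjesKernel v : ℂ)) ^ n)⁻¹ = (((-1) ^ n * (stieltjesKernel v)⁻¹ ^ n : ℝ) : ℂ) by
      push_cast; rw [neg_pow, mul_inv, inv_pow, ← inv_pow (-1 : ℂ)]; norm_num,
    im_mul_ofReal, mul_im, him, hre, sub_im, sub_re, I_re, I_im,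
    ofReal_re, ofReal_im]
  field_simp
  ring

/-- Both integrals measure the change of `Im H` between `π i` and `0`, for an entire primitive `H`
of the integrand. The curve leaves `π i` and approaches the positive real axis at infinity, where
`Im H` keeps its value at `0`. -/
lemma integral_inv_stieltjesKernel_pow {n : ℕ} (hn : 1 ≤ n) :
    (-1) ^ n * ∫ v in (0 : ℝ)..Real.pi, (stieltjesKernel v)⁻¹ ^ n =
      -∫ θ in (0 : ℝ)..Real.pi, (logIntegrand n (θ * I)).re := by
  obtain ⟨H, hH⟩ := (differentiable_logIntegrand n).isExactOn_univ
  replace hH : ∀ ζ, HasDerivAt H (logIntegrand n ζ) ζ := fun ζ => hH ζ (mem_univ ζ)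
  have hcirc : ∫ θ in (0 : ℝ)..Real.pi, (logIntegrand n (θ * I)).re =
      (H (Real.pi * I)).im - (H 0).im := by
    have hd : ∀ θ : ℝ, HasDerivAt (fun θ : ℝ => (H (θ * I)).im) (logIntegrand n (θ * I)).re θ := by
      intro θ
      have h1 : HasDerivAt (fun θ : ℝ => (θ : ℂ) * I) I θ := by
        have := ((hasDerivAt_id θ).ofReal_comp.mul_const I)
        rwa [ofReal_one, one_mul] at this
      have h2 := imCLM.hasFDerivAt.comp_hasDerivAt θ ((hH _).comp θ h1)
      rw [imCLM_apply, mul_I_im] at h2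
      exact h2
    rw [intervalIntegral.integral_eq_sub_of_hasDerivAt (fun θ _ => hd θ)]
    · simp
    · refine Continuous.intervalIntegrable ?_ _ _
      have := (differentiable_logIntegrand n).continuous
      fun_prop
  have hreal : ∀ x : ℝ, (H x).im = (H 0).im := by
    have hd : ∀ x : ℝ, HasDerivAt (fun x : ℝ => (H x).im) 0 x := by
      intro x
      have h2 := imCLM.hasFDerivAt.comp_hasDerivAt x (hH x).comp_ofReal
      have h3 : (logIntegrand n x).im = 0 := by
        rw [← conj_eq_iff_im, ← logIntegrand_conj, conj_ofReal]
      rw [imCLM_apply, h3] at h2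
      exact h2
    intro x
    simpa using is_const_of_deriv_eq_zero (fun x => (hd x).differentiableAt)
      (fun x => (hd x).deriv) x 0
  have hint : IntervalIntegrable (fun v => (-1) ^ n * (stieltjesKernel v)⁻¹ ^ n) volume
      0 Real.pi := by
    refine IntervalIntegrable.const_mul ?_ _
    refine (intervalIntegrable_const (c := Real.exp 1 ^ n)).mono_fun
      (measurable_stieltjesKernel.inv.pow_const n).aestronglyMeasurable ?_
    filter_upwards [ae_restrict_mem measurableSet_uIoc] with v hv
    have := inv_stieltjesKernel_mem_Icc (uIoc_zero_pi_subset hv)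
    rw [norm_pow, Real.norm_of_nonneg this.1]
    exact (pow_le_pow_left₀ this.1 this.2 n).trans (le_abs_self _)
  have hbd := intervalIntegral.integral_eq_sub_of_hasDerivAt_of_tendsto Real.pi_pos
    (f := fun v => (H (logBoundary v)).im) (fa := (H (Real.pi * I)).im) (fb := (H 0).im)
    (f' := fun v => (-1) ^ n * (stieltjesKernel v)⁻¹ ^ n)
    (fun v hv => by
      have h2 := imCLM.hasFDerivAt.comp_hasDerivAt v
        ((hH (logBoundary v)).comp v (hasDerivAt_logBoundary hv))
      rw [imCLM_apply, im_logIntegrand_logBoundary_mul n hv] at h2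
      exact h2)
    hint
    (by
      -- `sinc 0 = 1` makes the parametrized curve continuous at its starting point.
      have h0 : logBoundary 0 = Real.pi * I := by simp [logBoundary]
      have h1 : ContinuousAt logBoundary 0 := by
        unfold logBoundary
        have : ContinuousAt (fun v => Real.log (Real.sinc v)) 0 :=
          Real.continuous_sinc.continuousAt.log (by simp)
        fun_prop
      have h2 : ContinuousAt (fun v => (H (logBoundary v)).im) 0 :=
        continuous_im.continuousAt.comp ((hH _).continuousAt.comp h1)
      have := h2.tendsto
      rw [h0] at this
      exact this.mono_left nhdsWithin_le_nhds)
    (by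
      rw [tendsto_iff_norm_sub_tendsto_zero]
      have hlim : Tendsto (fun v : ℝ => Real.pi - v) (𝓝[<] Real.pi) (𝓝 0) := by
        have : ContinuousAt (fun v : ℝ => Real.pi - v) Real.pi := by fun_prop
        simpa using this.tendsto.mono_left nhdsWithin_le_nhds
      refine squeeze_zero' (Eventually.of_forall fun _ => norm_nonneg _) ?_ hlim
      filter_upwards [Ioo_mem_nhdsLT (show Real.pi / 2 < Real.pi by linarith [Real.pi_pos])]
        with v hv
      have hv' : v ∈ Ioo 0 Real.pi := ⟨by linarith [hv.1, Real.pi_pos], hv.2⟩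
      have hx : 0 ≤ -Real.log (Real.sinc v) :=
        neg_nonneg.2 (Real.log_nonpos (sinc_pos hv').le (Real.sinc_le_one v))
      have hconv : Convex ℝ ({ζ : ℂ | 0 ≤ ζ.re} ∩ {ζ | |ζ.im| ≤ Real.pi / 2}) := by
        refine (convex_halfSpace_re_ge (0 : ℝ)).inter ?_
        have : {ζ : ℂ | |ζ.im| ≤ Real.pi / 2} =
            {ζ | -(Real.pi / 2) ≤ ζ.im} ∩ {ζ | ζ.im ≤ Real.pi / 2} := by
          ext ζ; simp only [mem_inter_iff, mem_ofPred_eq, abs_le]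
        rw [this]
        exact (convex_halfSpace_im_ge _).inter (convex_halfSpace_im_le _)
      -- Compare with the vertical projection to the real axis: the distance is `π - v` and `‖H'‖ ≤
      -- 1` on this half-strip.
      have h1 := hconv.norm_image_sub_le_of_norm_hasDerivWithin_le (C := 1)
        (fun ζ _ => (hH ζ).hasDerivWithinAt)
        (fun ζ hζ => norm_logIntegrand_le_one hn hζ.1 hζ.2)
        (x := ((-Real.log (Real.sinc v) : ℝ) : ℂ)) (y := logBoundary v)
        ⟨by simpa using hx, by simpa using Real.pi_div_two_pos.le⟩
        ⟨by simpa [logBoundary] using hx, by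
          simp only [logBoundary, mem_ofPred_eq, add_im, ofReal_im, im_ofReal_mul, I_im, zero_add,
            mul_one]
          rw [abs_le]; constructor <;> linarith [hv.1, hv.2, Real.pi_pos]⟩
      have h2 : ‖logBoundary v - ((-Real.log (Real.sinc v) : ℝ) : ℂ)‖ = Real.pi - v := by
        rw [logBoundary, add_sub_cancel_left, norm_mul, norm_I, mul_one, norm_real,
          Real.norm_of_nonneg (by linarith [hv.2])]
      rw [h2, one_mul] at h1
      rw [← hreal (-Real.log (Real.sinc v)), ← sub_im]
      exact (abs_im_le_norm _).trans h1)
  rw [← intervalIntegral.integral_const_mul, hbd, hcirc]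
  ring

lemma circleIntegral_inv_mul_exp_pow (n : ℕ) :
    (∮ w in C(0, 1), ((w * exp w) ^ n)⁻¹) =
      2 * I * (∫ θ in (0 : ℝ)..Real.pi, (logIntegrand n (θ * I)).re : ℝ) := by
  have hc : Continuous fun θ : ℝ => logIntegrand n (θ * I) := by
    have := (differentiable_logIntegrand n).continuous
    fun_prop
  have h1 : (∮ w in C(0, 1), ((w * exp w) ^ n)⁻¹) =
      I * ∫ θ in (0 : ℝ)..2 * Real.pi, logIntegrand n (θ * I) := by
    rw [circleIntegral, ← intervalIntegral.integral_const_mul]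
    congr 1; ext θ
    simp only [deriv_circleMap, circleMap, logIntegrand_eq, ofReal_one, one_mul, zero_add,
      smul_eq_mul]
    ring
  have h2 : ∫ θ in Real.pi..2 * Real.pi, logIntegrand n (θ * I) =
      ∫ θ in (0 : ℝ)..Real.pi, (starRingEnd ℂ) (logIntegrand n (θ * I)) := by
    have := intervalIntegral.integral_comp_sub_left (a := 0) (b := Real.pi)
      (fun θ : ℝ => logIntegrand n (θ * I)) (2 * Real.pi)
    rw [show 2 * Real.pi - Real.pi = Real.pi by ring, sub_zero] at this
    rw [← this]
    congr 1; ext θ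
    rw [← logIntegrand_conj, logIntegrand_eq, logIntegrand_eq]
    have : exp (((2 * Real.pi - θ : ℝ) : ℂ) * I) = exp ((starRingEnd ℂ) (θ * I)) := by
      rw [map_mul, conj_ofReal, conj_I,
        show (((2 * Real.pi - θ : ℝ) : ℂ) * I) = θ * -I + 2 * Real.pi * I by push_cast; ring,
        exp_add, exp_two_pi_mul_I, mul_one]
    rw [this]
  rw [h1, ← intervalIntegral.integral_add_adjacent_intervals (hc.intervalIntegrable 0 Real.pi)
    (hc.intervalIntegrable _ _), h2, ← intervalIntegral.integral_add (hc.intervalIntegrable _ _)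
    (g := fun θ : ℝ => (starRingEnd ℂ) (logIntegrand n (θ * I)))
    ((continuous_conj.comp hc).intervalIntegrable _ _)]
  simp_rw [add_conj]
  rw [intervalIntegral.integral_ofReal, intervalIntegral.integral_const_mul]
  push_cast; ring

lemma moment_eq_circleIntegral {n : ℕ} (hn : 1 ≤ n) :
    ((∮ w in C(0, 1), ((w * exp w) ^ n)⁻¹)) =
      2 * I * ((-1) ^ (n - 1) * ∫ v in (0 : ℝ)..Real.pi, (stieltjesKernel v)⁻¹ ^ n : ℝ) := by
  rw [circleIntegral_inv_mul_exp_pow, ← neg_eq_iff_eq_neg.2 (integral_inv_stieltjesKernel_pow hn)]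
  obtain ⟨m, rfl⟩ := Nat.exists_eq_add_of_le' hn
  rw [Nat.add_sub_cancel, pow_succ]; push_cast; ring

/-! ### Inversion near the origin -/

lemma hasDerivAt_mul_exp (a : ℂ) :
    HasDerivAt (fun w : ℂ => w * exp w) ((1 + a) * exp a) a := by
  have := (hasDerivAt_id a).mul (hasDerivAt_exp a)
  rwa [id, one_mul, ← one_add_mul a] at this

/-- For `‖a‖ ≤ 1/10` and `‖w‖ ≤ 1`, this keeps the factor `‖a‖ * exp ‖a - w‖` below `1`; it also
gives `exp (1/10) / 10 < exp (-1)`. -/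
lemma exp_eleven_tenths_lt : Real.exp (11 / 10) < 10 := by
  have h : Real.exp (11 / 10) ≤ Real.exp 1 ^ 2 := by
    rw [← Real.exp_nat_mul]; exact Real.exp_le_exp.2 (by norm_num)
  have := Real.exp_one_lt_d9
  nlinarith [Real.exp_pos 1]

lemma eq_of_mul_exp_eq {a w : ℂ} (ha : ‖a‖ ≤ 1 / 10) (hw : ‖w‖ ≤ 1)
    (h : w * exp w = a * exp a) : w = a := by
  have h1 : w - a = a * (exp (a - w) - 1) := by
    have : w = a * exp (a - w) := by
      rw [exp_sub, ← mul_div_assoc, ← h, mul_div_cancel_right₀ _ (exp_ne_zero w)]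
    linear_combination this
  have h2 : ‖exp (a - w) - 1‖ ≤ ‖a - w‖ * Real.exp ‖a - w‖ := by
    simpa using norm_exp_sub_sum_le_norm_mul_exp (a - w) 1
  have h3 : ‖a - w‖ ≤ 11 / 10 := (norm_sub_le a w).trans (by linarith)
  have h4 : ‖a - w‖ = ‖a‖ * ‖exp (a - w) - 1‖ := by rw [norm_sub_rev, h1, norm_mul]
  have h5 : Real.exp ‖a - w‖ < 10 := (Real.exp_le_exp.2 h3).trans_lt exp_eleven_tenths_lt
  by_contra hne
  have h6 : 0 < ‖a - w‖ := norm_pos_iff.2 (sub_ne_zero.2 (Ne.symm hne))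
  have h7 : ‖a‖ * ‖exp (a - w) - 1‖ ≤ 1 / 10 * (‖a - w‖ * Real.exp ‖a - w‖) := by gcongr
  have h8 : ‖a - w‖ * Real.exp ‖a - w‖ < ‖a - w‖ * 10 := by gcongr
  linarith

lemma norm_mul_exp_lt {a : ℂ} (ha : ‖a‖ ≤ 1 / 10) : ‖a * exp a‖ < Real.exp (-1) := by
  rw [norm_mul, norm_exp]
  have h1 : Real.exp a.re ≤ Real.exp (1 / 10) :=
    Real.exp_le_exp.2 ((re_le_norm a).trans ha)
  have h2 : Real.exp (1 / 10) = Real.exp (-1) * Real.exp (11 / 10) := by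
    rw [← Real.exp_add]; norm_num
  have h3 : ‖a‖ * Real.exp a.re ≤ 1 / 10 * (Real.exp (-1) * Real.exp (11 / 10)) := by
    rw [← h2]; gcongr
  have := exp_eleven_tenths_lt
  have := mul_lt_mul_of_pos_left this (Real.exp_pos (-1))
  linarith

/-- The quotient of `w * exp w - a * exp a` by `w - a` extends to an entire `dslope` without zeros
in the closed unit disc; Cauchy's formula applies to its inverse. -/
lemma circleIntegral_inv_mul_exp_sub {a : ℂ} (ha : ‖a‖ ≤ 1 / 10) :
    (∮ w in C(0, 1), (w * exp w - a * exp a)⁻¹) =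
      2 * Real.pi * I * ((1 + a) * exp a)⁻¹ := by
  set f : ℂ → ℂ := fun w => w * exp w with hf
  have hq : Differentiable ℂ (dslope f a) := by
    rw [← differentiableOn_univ, differentiableOn_dslope univ_mem]
    intro w _
    exact (hasDerivAt_mul_exp w).differentiableAt.differentiableWithinAt
  have hqa : dslope f a a = (1 + a) * exp a := by
    rw [dslope_same, (hasDerivAt_mul_exp a).deriv]
  have hne : ∀ w ∈ Metric.closedBall (0 : ℂ) 1, dslope f a w ≠ 0 := by
    intro w hw h0
    by_cases hwa : w = a
    · subst hwa
      rw [hqa] at h0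
      have h1 := (mul_eq_zero.1 h0).resolve_right (exp_ne_zero _)
      have h2 : w = -1 := by linear_combination h1
      rw [h2] at ha
      norm_num at ha
    · have h1 := sub_smul_dslope f a w
      rw [h0, smul_zero] at h1
      exact hwa (eq_of_mul_exp_eq ha (by simpa using hw) (sub_eq_zero.1 h1.symm))
  have hd : DifferentiableOn ℂ (fun w => (dslope f a w)⁻¹) (Metric.closedBall 0 1) :=
    hq.differentiableOn.inv hne
  have := hd.circleIntegral_sub_inv_smul (w := a) (by
    rw [mem_ball_zero_iff]; linarith)
  rw [hqa, smul_eq_mul] at this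
  rw [← this]
  congr 1; ext w
  rw [smul_eq_mul, ← mul_inv, ← smul_eq_mul (w - a), sub_smul_dslope]

lemma hasSum_lambertDerivIntegral {z : ℂ} (hz : ‖z‖ < Real.exp (-1)) :
    HasSum (fun n : ℕ => ∫ v in (0 : ℝ)..Real.pi,
      (-z) ^ n * (((stieltjesKernel v)⁻¹ : ℝ) : ℂ) ^ (n + 1))
      (∫ v in (0 : ℝ)..Real.pi,
        (((stieltjesKernel v)⁻¹ : ℝ) : ℂ) / (1 + z * ((stieltjesKernel v)⁻¹ : ℝ))) := by
  have hr : ‖z‖ * Real.exp 1 < 1 := by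
    have := mul_lt_mul_of_pos_right hz (Real.exp_pos 1)
    rwa [← Real.exp_add, neg_add_cancel, Real.exp_zero] at this
  have hr0 : 0 ≤ ‖z‖ * Real.exp 1 := by positivity
  have hs := (summable_geometric_of_lt_one hr0 hr).mul_left (Real.exp 1)
  have hmeas : Measurable fun v => (((stieltjesKernel v)⁻¹ : ℝ) : ℂ) :=
    measurable_ofReal.comp measurable_stieltjesKernel.inv
  have hnorm : ∀ {v : ℝ}, v ∈ Set.uIoc 0 Real.pi →
      ‖(((stieltjesKernel v)⁻¹ : ℝ) : ℂ)‖ ≤ Real.exp 1 := by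
    intro v hv
    have := inv_stieltjesKernel_mem_Icc (uIoc_zero_pi_subset hv)
    rw [norm_real, Real.norm_of_nonneg this.1]
    exact this.2
  refine intervalIntegral.hasSum_integral_of_dominated_convergence
    (fun n _ => Real.exp 1 * (‖z‖ * Real.exp 1) ^ n)
    (fun n => ((hmeas.pow_const _).const_mul _).aestronglyMeasurable)
    (fun n => Eventually.of_forall fun v hv => ?_)
    (Eventually.of_forall fun v hv => hs) intervalIntegrable_const
    (Eventually.of_forall fun v hv => ?_)
  · rw [norm_mul, norm_pow, norm_pow, norm_neg, mul_pow, mul_left_comm, ← pow_succ']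
    have := hnorm hv
    gcongr
  · have h1 : ‖-z * ((stieltjesKernel v)⁻¹ : ℝ)‖ < 1 := by
      rw [norm_mul, norm_neg]
      exact (mul_le_mul_of_nonneg_left (hnorm hv) (norm_nonneg z)).trans_lt hr
    have h2 := (hasSum_geometric_of_norm_lt_one h1).mul_left (((stieltjesKernel v)⁻¹ : ℝ) : ℂ)
    rw [neg_mul, sub_neg_eq_add, ← div_eq_mul_inv] at h2
    exact h2.congr_fun fun n => by rw [← neg_mul, mul_pow]; ring

/-- On the unit circle `‖w * exp w‖ ≥ 1/e`, so the geometric series is dominated by powers of `‖z‖ *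
e < 1`. -/
lemma hasSum_circleIntegral_inv_mul_exp_sub {z : ℂ} (hz : ‖z‖ < Real.exp (-1)) :
    HasSum (fun n : ℕ => z ^ n * ∮ w in C(0, 1), ((w * exp w) ^ (n + 1))⁻¹)
      (∮ w in C(0, 1), (w * exp w - z)⁻¹) := by
  have hr : ‖z‖ * Real.exp 1 < 1 := by
    have := mul_lt_mul_of_pos_right hz (Real.exp_pos 1)
    rwa [← Real.exp_add, neg_add_cancel, Real.exp_zero] at this
  have hr0 : 0 ≤ ‖z‖ * Real.exp 1 := by positivity
  have hs := (summable_geometric_of_lt_one hr0 hr).mul_left (Real.exp 1)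
  have hc : Continuous (circleMap 0 1) := continuous_circleMap 0 1
  have hne : ∀ θ, circleMap 0 1 θ * exp (circleMap 0 1 θ) ≠ 0 := fun θ =>
    mul_ne_zero (circleMap_ne_center one_ne_zero) (exp_ne_zero _)
  have hnorm : ∀ θ, ‖(circleMap 0 1 θ * exp (circleMap 0 1 θ))⁻¹‖ ≤ Real.exp 1 := by
    intro θ
    have h1 : ‖circleMap 0 1 θ‖ = 1 := by simp
    rw [norm_inv, norm_mul, h1, one_mul, norm_exp, ← Real.exp_neg]
    have h2 := (abs_le.1 (abs_re_le_norm (circleMap 0 1 θ))).1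
    rw [h1] at h2
    exact Real.exp_le_exp.2 (by linarith)
  simp_rw [← smul_eq_mul (a := z ^ _), ← circleIntegral.integral_smul, circleIntegral]
  refine intervalIntegral.hasSum_integral_of_dominated_convergence
    (fun n _ => Real.exp 1 * (‖z‖ * Real.exp 1) ^ n)
    (fun n => Continuous.aestronglyMeasurable ?_)
    (fun n => Eventually.of_forall fun v hv => ?_)
    (Eventually.of_forall fun v hv => hs) intervalIntegrable_const
    (Eventually.of_forall fun θ hv => ?_)
  · simp only [deriv_circleMap]
    have : Continuous fun θ => ((circleMap 0 1 θ * exp (circleMap 0 1 θ)) ^ (n + 1))⁻¹ :=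
      Continuous.inv₀ (by fun_prop) fun θ => pow_ne_zero _ (hne θ)
    fun_prop
  · rw [norm_smul, norm_smul, norm_pow, ← inv_pow, norm_pow, deriv_circleMap, norm_mul, norm_I,
      norm_circleMap_zero, abs_one, one_mul, one_mul, mul_pow, pow_succ, mul_left_comm (Real.exp 1),
      mul_comm (Real.exp 1)]
    have := hnorm v
    gcongr
  · have h1 : ‖z * (circleMap 0 1 θ * exp (circleMap 0 1 θ))⁻¹‖ < 1 := by
      rw [norm_mul]
      exact (mul_le_mul_of_nonneg_left (hnorm θ) (norm_nonneg z)).trans_lt hr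
    have h2 := (hasSum_geometric_of_norm_lt_one h1).mul_left
      (deriv (circleMap 0 1) θ * (circleMap 0 1 θ * exp (circleMap 0 1 θ))⁻¹)
    rw [mul_assoc, ← mul_inv, mul_sub, mul_one, mul_left_comm, mul_inv_cancel₀ (hne θ),
      mul_one] at h2
    exact h2.congr_fun fun n => by
      rw [mul_pow z, smul_eq_mul, smul_eq_mul, ← inv_pow]; ring

lemma circleIntegral_eq_lambertDerivIntegral {z : ℂ} (hz : ‖z‖ < Real.exp (-1)) :
    (∮ w in C(0, 1), (w * exp w - z)⁻¹) = 2 * Real.pi * I * lambertDerivIntegral z := by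
  have h := (hasSum_lambertDerivIntegral hz).mul_left (2 * I)
  refine (hasSum_circleIntegral_inv_mul_exp_sub hz).unique ?_
  have hpi : (Real.pi : ℂ) ≠ 0 := ofReal_ne_zero.2 Real.pi_ne_zero
  have hval : 2 * Real.pi * I * lambertDerivIntegral z = 2 * I * ∫ v in (0 : ℝ)..Real.pi,
      (((stieltjesKernel v)⁻¹ : ℝ) : ℂ) / (1 + z * ((stieltjesKernel v)⁻¹ : ℝ)) := by
    rw [lambertDerivIntegral]
    generalize (∫ v in (0 : ℝ)..Real.pi, _ : ℂ) = J
    field_simp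
  rw [hval]
  refine h.congr_fun fun n => ?_
  rw [moment_eq_circleIntegral (Nat.le_add_left 1 n), intervalIntegral.integral_const_mul,
    Nat.add_sub_cancel, ofReal_mul, ← intervalIntegral.integral_ofReal, neg_pow]
  push_cast
  ring

lemma lambertDerivIntegral_mul_exp {a : ℂ} (ha : ‖a‖ ≤ 1 / 10) :
    lambertDerivIntegral (a * exp a) = ((1 + a) * exp a)⁻¹ := by
  have h := (circleIntegral_eq_lambertDerivIntegral (norm_mul_exp_lt ha)).symm.trans
    (circleIntegral_inv_mul_exp_sub ha)
  refine mul_left_cancel₀ ?_ h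
  simp [Real.pi_ne_zero]

lemma lambertIntegral_mul_exp {a : ℂ} (ha : ‖a‖ < 1 / 10) :
    lambertIntegral (a * exp a) = a := by
  have hd : ∀ b ∈ Metric.ball (0 : ℂ) (1 / 10),
      HasDerivAt (fun b => lambertIntegral (b * exp b) - b) 0 b := by
    intro b hb
    have hb' : ‖b‖ ≤ 1 / 10 := (mem_ball_zero_iff.1 hb).le
    have h1 := (intervalIntegrable_and_hasDerivAt_lambertIntegral fun s hs =>
      one_add_mul_mem_slitPlane_of_norm_lt (norm_mul_exp_lt hb') hs).2
    have h2 := (h1.comp b (hasDerivAt_mul_exp b)).sub (hasDerivAt_id b)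
    have h3 : (1 + b) * exp b ≠ 0 := by
      refine mul_ne_zero (fun h => ?_) (exp_ne_zero _)
      have : b = -1 := by linear_combination h
      rw [this] at hb'
      norm_num at hb'
    rw [lambertDerivIntegral_mul_exp hb', inv_mul_cancel₀ h3, sub_self] at h2
    exact h2
  have := (Metric.isOpen_ball (x := (0 : ℂ)) (ε := 1 / 10)).is_const_of_deriv_eq_zero
    (convex_ball _ _).isPreconnected
    (fun b hb => (hd b hb).differentiableAt.differentiableWithinAt)
    (fun b hb => (hd b hb).deriv) (mem_ball_zero_iff.2 ha) (Metric.mem_ball_self (by norm_num))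
  simpa [lambertIntegral_zero, sub_eq_zero] using this

/-! ### Continuation to the cut plane and identification with `W` -/

lemma hasDerivAt_lambertIntegral {z : ℂ} (hz : z ∈ slitPlane) :
    HasDerivAt lambertIntegral (lambertDerivIntegral z) z :=
  (intervalIntegrable_and_hasDerivAt_lambertIntegral fun _ hs =>
    one_add_mul_mem_slitPlane hz hs.1).2

lemma lambertIntegral_mul_exp_lambertIntegral {z : ℂ} (hz : z ∈ slitPlane) :
    lambertIntegral z * exp (lambertIntegral z) = z := by
  have hG : AnalyticOnNhd ℂ (fun z => lambertIntegral z * exp (lambertIntegral z)) slitPlane := by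
    refine DifferentiableOn.analyticOnNhd (fun w hw => ?_) isOpen_slitPlane
    have := (hasDerivAt_lambertIntegral hw).differentiableAt
    exact (this.mul this.cexp).differentiableWithinAt
  have hpre : IsPreconnected slitPlane :=
    (starConvex_one_slitPlane.isPathConnected one_mem_slitPlane).isConnected.isPreconnected
  -- Since `0` is outside the slit plane, the identity theorem is anchored at the image of a
  -- positive real below `1/10`. As `w * exp w` has nonzero derivative there, neighbourhoods of `a₀`
  -- map onto neighbourhoods of the image.
  set a₀ : ℂ := ((1 / 20 : ℝ) : ℂ) with ha₀
  have hz₀ : a₀ * exp a₀ ∈ slitPlane := by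
    rw [ha₀, ← ofReal_exp, ← ofReal_mul, ofReal_mem_slitPlane]
    positivity
  refine hG.eqOn_of_preconnected_of_eventuallyEq analyticOnNhd_id hpre hz₀ ?_ hz
  have hstrict : HasStrictDerivAt (fun w : ℂ => w * exp w) ((1 + a₀) * exp a₀) a₀ := by
    have := (hasStrictDerivAt_id a₀).mul (hasStrictDerivAt_exp a₀)
    rwa [id, one_mul, ← one_add_mul a₀] at this
  have hne : (1 + a₀) * exp a₀ ≠ 0 := by
    refine mul_ne_zero ?_ (exp_ne_zero _)
    rw [ha₀]; norm_num
  rw [EventuallyEq, ← hstrict.map_nhds_eq hne, eventually_map]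
  have hball : a₀ ∈ Metric.ball (0 : ℂ) (1 / 10) := by
    rw [mem_ball_zero_iff, ha₀, norm_real]; norm_num
  filter_upwards [Metric.isOpen_ball.mem_nhds hball] with a ha
  rw [lambertIntegral_mul_exp (mem_ball_zero_iff.1 ha)]

lemma intervalIntegrable_log_one_add {z : ℂ} (hz : z ∈ slitPlane) :
    IntervalIntegrable (fun v => log (1 + z * ((stieltjesKernel v)⁻¹ : ℝ))) volume 0 Real.pi :=
  intervalIntegrable_comp_inv_stieltjesKernel (g := fun s => log (1 + z * s)) (by fun_prop)
    (ContinuousOn.clog (by fun_prop) fun _ hs => one_add_mul_mem_slitPlane hz hs.1)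

lemma intervalIntegrable_arg_one_add {z : ℂ} (hz : z ∈ slitPlane) :
    IntervalIntegrable (fun v => arg (1 + z * ((stieltjesKernel v)⁻¹ : ℝ))) volume 0 Real.pi := by
  have h := intervalIntegrable_log_one_add hz
  have h1 := h.1.im
  have h2 := h.2.im
  simp only [RCLike.im_eq_complex_im, log_im] at h1 h2
  exact ⟨h1, h2⟩

lemma lambertIntegral_im {z : ℂ} (hz : z ∈ slitPlane) : (lambertIntegral z).im =
    1 / Real.pi * ∫ v in (0 : ℝ)..Real.pi, arg (1 + z * ((stieltjesKernel v)⁻¹ : ℝ)) := by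
  have h := imCLM.intervalIntegral_comp_comm (intervalIntegrable_log_one_add hz)
  simp only [imCLM_apply, log_im] at h
  rw [lambertIntegral, show (1 / (Real.pi : ℂ)) = ((1 / Real.pi : ℝ) : ℂ) by push_cast; rfl,
    im_ofReal_mul, h]

lemma lambertIntegral_re {z : ℂ} (hz : z ∈ slitPlane) : (lambertIntegral z).re =
    1 / Real.pi * ∫ v in (0 : ℝ)..Real.pi,
      Real.log ‖1 + z * ((stieltjesKernel v)⁻¹ : ℝ)‖ := by
  have h := reCLM.intervalIntegral_comp_comm (intervalIntegrable_log_one_add hz)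
  simp only [reCLM_apply, log_re] at h
  rw [lambertIntegral, show (1 / (Real.pi : ℂ)) = ((1 / Real.pi : ℝ) : ℂ) by push_cast; rfl,
    re_ofReal_mul, h]

/-- For nonreal `z`, averaging arguments in `(-π, π)` with the sign of `z.im` bounds the imaginary
part. The sign of `Im (w * exp w) = z.im` then decides the side of the curve. -/
lemma lambertIntegral_mem_lambertRange {z : ℂ} (hz : z ∈ slitPlane) :
    lambertIntegral z ∈ lambertRange := by
  have hpi := Real.pi_pos
  have hpi' : 0 < 1 / Real.pi := by positivity
  have hi := intervalIntegrable_arg_one_add hz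
  have heq := lambertIntegral_mul_exp_lambertIntegral hz
  have him := lambertIntegral_im hz
  have hsl : ∀ v ∈ Ioo 0 Real.pi, 1 + z * ((stieltjesKernel v)⁻¹ : ℝ) ∈ slitPlane :=
    fun v hv => one_add_mul_mem_slitPlane hz (inv_pos.2 (stieltjesKernel_pos hv)).le
  have harg : ∀ v ∈ Ioo 0 Real.pi, |arg (1 + z * ((stieltjesKernel v)⁻¹ : ℝ))| < Real.pi :=
    fun v hv => abs_lt.2 ⟨neg_pi_lt_arg _,
      (arg_le_pi _).lt_of_ne (mem_slitPlane_iff_arg.1 (hsl v hv)).1⟩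
  have hpint : ∫ v in (0 : ℝ)..Real.pi, Real.pi = Real.pi * Real.pi := by simp
  have hmul : 1 / Real.pi * (Real.pi * Real.pi) = Real.pi := by field_simp
  have himz : ∀ v : ℝ, (1 + z * ((stieltjesKernel v)⁻¹ : ℝ)).im =
      z.im * (stieltjesKernel v)⁻¹ := fun v => by simp only [add_im, one_im, im_mul_ofReal, zero_add]
  rcases lt_trichotomy z.im 0 with h | h | h
  · have h1 := intervalIntegral.intervalIntegral_pos_of_pos_on hi.neg (fun v hv => by
      refine neg_pos.2 (arg_neg_iff.2 ?_)
      rw [himz]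
      exact mul_neg_of_neg_of_pos h (inv_pos.2 (stieltjesKernel_pos hv))) hpi
    have h2 := intervalIntegral.intervalIntegral_pos_of_pos_on
      ((intervalIntegrable_const (c := Real.pi)).add hi) (fun v hv => by
        have := (abs_lt.1 (harg v hv)).1
        linarith) hpi
    simp only [Pi.neg_apply] at h1
    rw [intervalIntegral.integral_neg] at h1
    rw [intervalIntegral.integral_add intervalIntegrable_const hi, hpint] at h2
    have h3 := mul_pos hpi' h1
    have h4 := mul_pos hpi' h2
    rw [mul_neg, ← him] at h3
    rw [mul_add, hmul, ← him] at h4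
    refine Or.inr (Or.inr ⟨by linarith, by linarith, ?_⟩)
    rw [← im_mul_exp_neg_iff ⟨by linarith, by linarith⟩, heq]
    exact h
  · have hre : 0 < z.re := hz.resolve_right (by simp [h])
    have hone : ∀ v ∈ Ioo 0 Real.pi, 1 ≤ (1 + z * ((stieltjesKernel v)⁻¹ : ℝ)).re := by
      intro v hv
      have := mul_pos hre (inv_pos.2 (stieltjesKernel_pos hv))
      simp only [add_re, one_re, re_mul_ofReal]
      linarith
    refine Or.inr (Or.inl ⟨?_, ?_⟩)
    · rw [him, intervalIntegral.integral_congr_Ioo_of_le hpi.le (g := fun _ => 0)]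
      · simp
      · intro v hv
        exact arg_eq_zero_iff.2 ⟨by linarith [hone v hv], by rw [himz, h, zero_mul]⟩
    · have : 0 ≤ (lambertIntegral z).re := by
        rw [lambertIntegral_re hz]
        refine mul_nonneg hpi'.le ?_
        rw [intervalIntegral.integral_of_le hpi.le, integral_Ioc_eq_integral_Ioo]
        refine setIntegral_nonneg measurableSet_Ioo fun v hv => Real.log_nonneg ?_
        exact (hone v hv).trans (re_le_norm _)
      linarith
  · have h1 := intervalIntegral.intervalIntegral_pos_of_pos_on hi (fun v hv => by
      have h5 := mul_pos h (inv_pos.2 (stieltjesKernel_pos hv))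
      rw [← himz] at h5
      refine (arg_nonneg_iff.2 h5.le).lt_of_ne fun h6 => h5.ne' ?_
      exact (arg_eq_zero_iff.1 h6.symm).2) hpi
    have h2 := intervalIntegral.intervalIntegral_pos_of_pos_on
      ((intervalIntegrable_const (c := Real.pi)).sub hi) (fun v hv => by
        have := (abs_lt.1 (harg v hv)).2
        linarith) hpi
    rw [intervalIntegral.integral_sub intervalIntegrable_const hi, hpint] at h2
    have h3 := mul_pos hpi' h1
    have h4 := mul_pos hpi' h2
    rw [← him] at h3
    rw [mul_sub, hmul, ← him] at h4
    refine Or.inl ⟨h3, by linarith, le_of_lt ?_⟩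
    rw [← im_mul_exp_pos_iff ⟨h3, by linarith⟩, heq]
    exact h

lemma lambertW_eq_lambertIntegral {z : ℂ} (hz : z ∈ slitPlane) : lambertW z = lambertIntegral z := by
  have hex : ∃ w ∈ lambertRange, (fun w : ℂ => w * exp w) w = z :=
    ⟨_, lambertIntegral_mem_lambertRange hz, lambertIntegral_mul_exp_lambertIntegral hz⟩
  have h1 : lambertW z * exp (lambertW z) = z := Function.invFunOn_eq hex
  exact mul_exp_injOn_lambertRange (Function.invFunOn_mem hex) (lambertIntegral_mem_lambertRange hz)
    (h1.trans (lambertIntegral_mul_exp_lambertIntegral hz).symm) (by rwa [h1])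

/-! ### The Stieltjes representation -/

lemma one_div_add_stieltjesKernel (z : ℂ) : EqOn
    (fun v => (((stieltjesKernel v)⁻¹ : ℝ) : ℂ) / (1 + z * ((stieltjesKernel v)⁻¹ : ℝ)))
    (fun v : ℝ => 1 / (z + (stieltjesKernel v : ℂ))) (Ioo 0 Real.pi) := by
  intro v hv
  have hne : (stieltjesKernel v : ℂ) ≠ 0 := ofReal_ne_zero.2 (stieltjesKernel_pos hv).ne'
  have : z + (stieltjesKernel v : ℂ) =
      (1 + z * ((stieltjesKernel v)⁻¹ : ℝ)) * stieltjesKernel v := by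
    push_cast; field_simp; ring
  simp only [this, ofReal_inv]
  rw [one_div, mul_inv, mul_comm, div_eq_mul_inv, mul_comm]

lemma intervalIntegrable_one_div_add {z : ℂ} (hz : z ∈ slitPlane) :
    IntervalIntegrable (fun v : ℝ => 1 / (z + (stieltjesKernel v : ℂ))) volume 0 Real.pi := by
  have h := (intervalIntegrable_and_hasDerivAt_lambertIntegral fun s hs =>
    one_add_mul_mem_slitPlane hz hs.1).1
  rw [intervalIntegrable_iff_integrableOn_Ioo_of_le Real.pi_pos.le] at h ⊢
  exact h.congr_fun (one_div_add_stieltjesKernel z) measurableSet_Ioo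

lemma hasDerivAt_lambertW {z : ℂ} (hz : z ∈ slitPlane) : HasDerivAt lambertW
    (1 / (Real.pi : ℂ) * ∫ v in (0 : ℝ)..Real.pi, 1 / (z + (stieltjesKernel v : ℂ))) z := by
  have h := hasDerivAt_lambertIntegral hz
  rw [lambertDerivIntegral, intervalIntegral.integral_congr_Ioo_of_le Real.pi_pos.le
    (one_div_add_stieltjesKernel z)] at h
  refine h.congr_of_eventuallyEq ?_
  filter_upwards [isOpen_slitPlane.mem_nhds hz] with w hw
  exact lambertW_eq_lambertIntegral hw

lemma hasStieltjesRepresentation_deriv_lambertW :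
    HasStieltjesRepresentation (deriv lambertW) 0 lambertDerivMeasure where
  nonneg := le_rfl
  supported := by
    rw [lambertDerivMeasure, Measure.map_apply measurable_stieltjesKernel measurableSet_Iio,
      Measure.smul_apply, Measure.restrict_apply (measurable_stieltjesKernel measurableSet_Iio)]
    have : stieltjesKernel ⁻¹' Iio 0 ∩ Ioo 0 Real.pi = ∅ := by
      ext v
      simp only [mem_inter_iff, mem_preimage, mem_Iio, mem_empty_iff_false, iff_false]
      exact fun h => (stieltjesKernel_pos h.2).not_gt h.1
    simp [this]
  finite := by
    rw [lambertDerivMeasure, lintegral_map (by fun_prop) measurable_stieltjesKernel,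
      lintegral_smul_measure]
    refine ENNReal.mul_lt_top ENNReal.ofReal_lt_top ?_
    -- The measure has finite total mass, so bounding the weight by `1` is enough.
    calc _ ≤ ∫⁻ _ in Ioo 0 Real.pi, 1 := by
          refine setLIntegral_mono measurable_const fun v hv => ?_
          have := stieltjesKernel_pos hv
          exact ENNReal.ofReal_le_one.2 (inv_le_one_of_one_le₀ (by linarith))
      _ < ⊤ := by simp
  integrable z hz := by
    have hmeas : Measurable fun t : ℝ => 1 / (z + (t : ℂ)) := by fun_prop
    rw [lambertDerivMeasure, integrable_map_measure hmeas.aestronglyMeasurable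
      measurable_stieltjesKernel.aemeasurable]
    exact ((intervalIntegrable_iff_integrableOn_Ioo_of_le Real.pi_pos.le).1
      (intervalIntegrable_one_div_add hz)).smul_measure ENNReal.ofReal_ne_top
  eq_integral z hz := by
    have hmeas : Measurable fun t : ℝ => 1 / (z + (t : ℂ)) := by fun_prop
    rw [(hasDerivAt_lambertW hz).deriv, lambertDerivMeasure, integral_map
      measurable_stieltjesKernel.aemeasurable hmeas.aestronglyMeasurable, integral_smul_measure,
      intervalIntegral.integral_of_le Real.pi_pos.le, integral_Ioc_eq_integral_Ioo,
      ENNReal.toReal_ofReal (by positivity), real_smul]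
    simp

theorem mainTheorem5 :
    (∀ z ∈ Complex.slitPlane,
      IntervalIntegrable (fun v : ℝ => 1 / (z + (stieltjesKernel v : ℂ)))
        MeasureTheory.volume 0 Real.pi ∧
      HasDerivAt lambertW
        (1 / (Real.pi : ℂ) * ∫ v in (0 : ℝ)..Real.pi, 1 / (z + (stieltjesKernel v : ℂ))) z) ∧
    HasStieltjesRepresentation (deriv lambertW) 0 lambertDerivMeasure :=
  ⟨fun _ hz => ⟨intervalIntegrable_one_div_add hz, hasDerivAt_lambertW hz⟩,
    hasStieltjesRepresentation_deriv_lambertW⟩
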